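/- For $d\in\mathbb{N}=\{1,2,\dots\}$ and $r\in\mathbb{N}$ let $\mathcal{C}^r_d$ be the class of all $f\in C^r([0,1]^d)$, real-valued, with $\|D^\beta f\|_\infty\le 1$ for all $\beta\in\mathbb{N}_0^d$ with $|\beta|\le r$. A (deterministic, adaptive) algorithm of cost $n\in\mathbb{N}_0$ is a map $A(f)=\varphi(f(x_1),\dots,f(x_n))$, where each point $x_i\in[0,1]^d$ may be chosen depending on $f(x_1),\dots,f(x_{i-1})$, and $\varphi:\mathbb{R}^n\to L_\infty([0,1]^d)$ is arbitrary. For a class $F$ of continuous functions on $[0,1]^d$ let $$e^{\rm app}(n,F)=\inf\Big\{\sup_{f\in F}\|f-A(f)\|_\infty \;\Big|\; A \text{ an algorithm of cost at most } n\Big\},\qquad n^{\rm app}(\varepsilon,F)=\min\{n\in\mathbb{N}_0 \mid e^{\rm app}(n,F)\le\varepsilon\}.$$ Theorem. Let $r\ge 3$ be odd. Then there are positive constants $c_r$, $C_r$ and $\varepsilon_r$, depending only on $r$, such that $$\big(c_r\sqrt{d}\,\varepsilon^{-1/r}\big)^d\;\le\; n^{\rm app}(\varepsilon,\mathcal{C}^r_d)\;\le\;\big(C_r\,d^{\frac{r+1}{2r}}\,\varepsilon^{-1/r}\big)^d$$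 for all $d\in\mathbb{N}$ and $\varepsilon\in(0,\varepsilon_r)$. The upper bound holds for all $\varepsilon>0$ (and all $d\in\mathbb{N}$). -/

import Mathlib

open MeasureTheory
open scoped ENNReal

noncomputable section

/-- The unit cube `[0,1]^d` (in the order on `Fin d → ℝ` this is the product of the intervals). -/
def unitCube (d : ℕ) : Set (Fin d → ℝ) := Set.Icc 0 1

/-- The partial derivative `∂^k f / ∂x_{j 0} ⋯ ∂x_{j (k-1)}` of order `k` on the cube
(one-sided at the boundary). For `f` of class `C^k` it is independent of the order of the
directions, so that it equals `D^β f` where `β i` is the number of occurrences of `i` in `j`;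
conversely each multi-index `β` with `|β| = k` arises from such a `j`. -/
def cubePartial {d k : ℕ} (j : Fin k → Fin d) (f : (Fin d → ℝ) → ℝ) (x : Fin d → ℝ) : ℝ :=
  iteratedFDerivWithin ℝ k f (unitCube d) x (fun i => Pi.single (j i) (1 : ℝ))

/-- The class `𝒞^r_d` of the `C^r` functions on `[0,1]^d` all of whose partial derivatives of
order at most `r` (order `0` included) are bounded by one in absolute value on the cube.
A function on the cube is represented by a function on `ℝ^d`, whose values outside of the cube
are irrelevant. -/
def smoothClass (r d : ℕ) : Set ((Fin d → ℝ) → ℝ) :=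
  {f | ContDiffOn ℝ (r : WithTop ℕ∞) f (unitCube d) ∧
    ∀ k : ℕ, k ≤ r → ∀ j : Fin k → Fin d, ∀ x ∈ unitCube d, |cubePartial j f x| ≤ 1}

/-- A deterministic algorithm `A = φ ∘ N` for the approximation of functions on `[0,1]^d`, with
adaptively chosen sample points: `point i y` is the `(i+1)`-st point, chosen from the `i` function
values `y` that are already computed; only the first `cost` points are used. The map `output`
from the computed values to `L_∞([0,1]^d)` is arbitrary. -/
structure ApproxAlgorithm (d : ℕ) where
  /-- the number of computed function values -/
  cost : ℕ
  /-- the choice of the next sample point -/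
  point : (i : ℕ) → (Fin i → ℝ) → unitCube d
  /-- the map `φ` -/
  output : (Fin cost → ℝ) → Lp ℝ ∞ (volume.restrict (unitCube d))

namespace ApproxAlgorithm

variable {d : ℕ}

/-- The vector `(f(x_1), …, f(x_n))` of the first `n` function values that are computed. -/
def info (A : ApproxAlgorithm d) (f : (Fin d → ℝ) → ℝ) : (n : ℕ) → Fin n → ℝ
  | 0 => Fin.elim0
  | n + 1 => Fin.snoc (A.info f n) (f (A.point n (A.info f n)))

/-- The approximation `A(f) = φ(N(f))`. -/
def apply (A : ApproxAlgorithm d) (f : (Fin d → ℝ) → ℝ) :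
    Lp ℝ ∞ (volume.restrict (unitCube d)) :=
  A.output (A.info f A.cost)

/-- The worst case error `e^app(A, F) = sup_{f ∈ F} ‖f - A(f)‖_∞`, with values in `[0, ∞]`. -/
def worstError (A : ApproxAlgorithm d) (F : Set ((Fin d → ℝ) → ℝ)) : ℝ≥0∞ :=
  ⨆ f ∈ F, eLpNorm (fun x => f x - A.apply f x) ∞ (volume.restrict (unitCube d))

end ApproxAlgorithm

/-- The `n`-th minimal worst case error
`e^app(n, F) = inf {e^app(A, F) | cost(A) ≤ n}`. -/
def minError {d : ℕ} (n : ℕ) (F : Set ((Fin d → ℝ) → ℝ)) : ℝ≥0∞ :=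
  ⨅ (A : ApproxAlgorithm d) (_ : A.cost ≤ n), A.worstError F

/-- The information complexity `n^app(ε, F) = min {n ∈ ℕ₀ | e^app(n, F) ≤ ε}`, with the value `⊤`
if there is no such `n`. -/
def nApp {d : ℕ} (ε : ℝ) (F : Set ((Fin d → ℝ) → ℝ)) : ℕ∞ :=
  ⨅ (n : ℕ) (_ : minError n F ≤ ENNReal.ofReal ε), (n : ℕ∞)

end

/-! Upper bound. Functions are sampled on a grid of mesh `1 / (N r)`. If two members of the class
agree there, their difference `u` vanishes on the grid and its partials are bounded by 2, so it
suffices to bound `u` off the grid without a factor exponential in `d`. In each coordinate the unit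
mass at `x i` is written as `p + (q - p) + (δ - q)`, where `p` is linear interpolation from the ends
of a cell of length `h = 1 / N` and `q` is Lagrange interpolation of degree `r`. Three facts matter:
`p` has total mass at most 1, so it costs nothing however often it occurs; `q - p` kills affine
functions and gains `h ^ 2`; `δ - q` kills degree below `r` and gains `h ^ r`. The tensor product is
expanded one coordinate at a time, and a branch stops at its first factor `δ - q` or at its `m`-th
factor `q - p`, where `r + 1 = 2 * m`. Either way the branch is at most a constant times `h ^ r`: in
the second case `m - 1` factors gain `h ^ 2` and the last gains `h`, which uses exactly `r`
derivatives because `r` is odd. Branches that never stop only see grid values and vanish. At most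
`(2 * d + 1) ^ m` branches stop (`abs_coordIntegral_le_of_eq_zero`), so `h ^ r * d ^ m` of order `ε`
suffices, which gives the exponent `(r + 1) / (2 r)` of `d`. Lower bound. A radial bump of Euclidean
radius `R` has derivatives of order `k` bounded by a multiple of `R⁻¹ ^ k` independent of `d`, so
the class contains bumps of height `2 * ε` with `R ^ r` proportional to `ε`. Balls of radius `R`
have volume at most `(const * R / √d) ^ d`; fewer balls than the reciprocal of this, centred at the
points sampled for the zero function, miss some interior point. A bump there and its negative are
indistinguishable from zero. -/

/-! ### Bounded partial derivatives on the cube -/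

/-- `u` has one-coordinate derivatives up to order `n` on the unit cube, in every succession of
coordinates, and all of them (with `u` itself) are bounded by `M` there. -/
def PartialsBounded {d : ℕ} : ℕ → ℝ → ((Fin d → ℝ) → ℝ) → Prop
  | 0, M, u => ∀ x ∈ unitCube d, |u x| ≤ M
  | n + 1, M, u => (∀ x ∈ unitCube d, |u x| ≤ M) ∧ ∀ i, ∃ v, PartialsBounded n M v ∧
      ∀ x ∈ unitCube d,
        HasDerivWithinAt (fun t => u (Function.update x i t)) (v x) (Set.Icc 0 1) (x i)

theorem PartialsBounded.abs_le {d n : ℕ} {M : ℝ} {u : (Fin d → ℝ) → ℝ}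
    (hu : PartialsBounded n M u) {x : Fin d → ℝ} (hx : x ∈ unitCube d) : |u x| ≤ M := by
  cases n with
  | zero => exact hu x hx
  | succ n => exact hu.1 x hx

theorem PartialsBounded.sub {d n : ℕ} {M M' : ℝ} {u v : (Fin d → ℝ) → ℝ}
    (hu : PartialsBounded n M u) (hv : PartialsBounded n M' v) :
    PartialsBounded n (M + M') (fun x => u x - v x) := by
  induction n generalizing u v with
  | zero => exact fun x hx => (abs_sub _ _).trans (add_le_add (hu x hx) (hv x hx))
  | succ n ih =>
    refine ⟨fun x hx => (abs_sub _ _).trans (add_le_add (hu.1 x hx) (hv.1 x hx)), fun i => ?_⟩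
    obtain ⟨u', hu', h⟩ := hu.2 i
    obtain ⟨v', hv', h'⟩ := hv.2 i
    exact ⟨_, ih hu' hv', fun x hx => (h x hx).sub (h' x hx)⟩

/-- Spending `a` of the available derivatives in one coordinate leaves `n` for the others; this is
how the derivative budget is tracked. -/
theorem PartialsBounded.exists_iterated {d n a : ℕ} {M : ℝ} {u : (Fin d → ℝ) → ℝ}
    (hu : PartialsBounded (n + a) M u) (i : Fin d) :
    ∃ v : ℕ → (Fin d → ℝ) → ℝ, v 0 = u ∧ PartialsBounded n M (v a) ∧
      ∀ k < a, ∀ x ∈ unitCube d,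
        HasDerivWithinAt (fun t => v k (Function.update x i t)) (v (k + 1) x)
          (Set.Icc 0 1) (x i) := by
  induction a generalizing u with
  | zero => exact ⟨fun _ => u, rfl, hu, by simp⟩
  | succ a ih =>
    obtain ⟨u', hu', h⟩ := hu.2 i
    obtain ⟨v, hv0, hva, hv⟩ := ih hu'
    refine ⟨fun k => k.casesOn u v, rfl, hva, fun k hk => ?_⟩
    cases k with
    | zero =>
      change ∀ x ∈ unitCube d,
        HasDerivWithinAt (fun t => u (Function.update x i t)) (v 0 x) (Set.Icc 0 1) (x i)
      rwa [hv0]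
    | succ k => exact hv k (by omega)

theorem uniqueDiffOn_unitCube (d : ℕ) : UniqueDiffOn ℝ (unitCube d) := by
  have : unitCube d = Set.univ.pi fun _ => Set.Icc (0 : ℝ) 1 := by
    ext x; simp [unitCube, Set.mem_Icc, Pi.le_def]
  rw [this]
  exact UniqueDiffOn.univ_pi fun _ => uniqueDiffOn_Icc one_pos

theorem mem_unitCube_iff {d : ℕ} {x : Fin d → ℝ} :
    x ∈ unitCube d ↔ ∀ i, x i ∈ Set.Icc (0 : ℝ) 1 := by
  simp [unitCube, Set.mem_Icc, Pi.le_def, forall_and]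

theorem update_mem_unitCube {d : ℕ} {x : Fin d → ℝ} (hx : x ∈ unitCube d) {t : ℝ}
    (ht : t ∈ Set.Icc (0 : ℝ) 1) (i : Fin d) : Function.update x i t ∈ unitCube d := by
  rw [mem_unitCube_iff] at *
  intro j
  by_cases h : j = i
  · subst h; simpa using ht
  · simpa [h] using hx j

theorem hasDerivWithinAt_cubePartial {r d k : ℕ} {f : (Fin d → ℝ) → ℝ}
    (hf : ContDiffOn ℝ (r : WithTop ℕ∞) f (unitCube d)) (hk : k < r) (j : Fin k → Fin d)
    (i : Fin d) {x : Fin d → ℝ} (hx : x ∈ unitCube d) :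
    HasDerivWithinAt (fun t => cubePartial j f (Function.update x i t))
      (cubePartial (Fin.cons i j : Fin (k + 1) → Fin d) f x) (Set.Icc 0 1) (x i) := by
  have hD : DifferentiableWithinAt ℝ (iteratedFDerivWithin ℝ k f (unitCube d)) (unitCube d) x :=
    hf.differentiableOn_iteratedFDerivWithin (by exact_mod_cast hk) (uniqueDiffOn_unitCube d) x hx
  have h1 : HasDerivWithinAt (Function.update x i) (Pi.single i (1 : ℝ)) (Set.Icc 0 1) (x i) :=
    (hasDerivAt_update x i (x i)).hasDerivWithinAt
  have h2 := HasFDerivWithinAt.comp_hasDerivWithinAt_of_eq (x i) (t := unitCube d)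
    hD.hasFDerivWithinAt h1 (fun t ht => update_mem_unitCube hx ht i) (by simp)
  have h3 := (ContinuousMultilinearMap.apply ℝ (fun _ : Fin k => (Fin d → ℝ)) ℝ
    (fun l => Pi.single (j l) (1 : ℝ))).hasFDerivAt.comp_hasDerivWithinAt (x i) h2
  refine h3.congr_deriv ?_
  rw [cubePartial, iteratedFDerivWithin_succ_apply_left]
  simp only [Fin.cons_zero, ContinuousMultilinearMap.apply_apply]
  congr 1

theorem partialsBounded_cubePartial {r d : ℕ} {f : (Fin d → ℝ) → ℝ} (hf : f ∈ smoothClass r d)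
    {n k : ℕ} (h : k + n ≤ r) (j : Fin k → Fin d) : PartialsBounded n 1 (cubePartial j f) := by
  induction n generalizing k with
  | zero => exact hf.2 k (by omega) j
  | succ n ih =>
    refine ⟨hf.2 k (by omega) j, fun i => ⟨_, ih (by omega) (Fin.cons i j), fun x hx => ?_⟩⟩
    exact hasDerivWithinAt_cubePartial hf.1 (by omega) j i hx

theorem partialsBounded_of_mem_smoothClass {r d : ℕ} {f : (Fin d → ℝ) → ℝ}
    (hf : f ∈ smoothClass r d) : PartialsBounded r 1 f := by
  have := partialsBounded_cubePartial hf (n := r) (k := 0) (by omega) Fin.elim0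
  have h : cubePartial (Fin.elim0 : Fin 0 → Fin d) f = f := by
    ext x; simp [cubePartial]
  rwa [h] at this

/-! ### Local polynomial approximation in one variable -/

/-- On a subinterval of length `h`, a function with `a` derivatives is within `B * h ^ a` of a
polynomial of degree less than `a`, where `B` bounds the last derivative. -/
theorem exists_polynomial_approx {φ : ℕ → ℝ → ℝ} {a : ℕ} {B α h : ℝ} (hh : 0 ≤ h)
    (hsub : Set.Icc α (α + h) ⊆ Set.Icc 0 1)
    (hφ : ∀ k < a, ∀ t ∈ Set.Icc (0 : ℝ) 1,
      HasDerivWithinAt (φ k) (φ (k + 1) t) (Set.Icc 0 1) t)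
    (hB : ∀ t ∈ Set.Icc (0 : ℝ) 1, |φ a t| ≤ B) :
    ∃ c : ℕ → ℝ, ∀ t ∈ Set.Icc α (α + h),
      |φ 0 t - ∑ k ∈ Finset.range a, c k * t ^ k| ≤ B * h ^ a := by
  induction a generalizing φ with
  | zero => exact ⟨0, fun t ht => by simpa using hB t (hsub ht)⟩
  | succ a ih =>
    obtain ⟨c, hc⟩ := ih (φ := fun k => φ (k + 1)) (fun k hk => hφ (k + 1) (by omega)) hB
    set P : ℝ → ℝ := fun t => ∑ k ∈ Finset.range a, c k / (k + 1) * t ^ (k + 1) with hP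
    have hP' : ∀ t, HasDerivAt P (∑ k ∈ Finset.range a, c k * t ^ k) t := by
      intro t
      refine HasDerivAt.fun_sum fun k _ => ?_
      have := (hasDerivAt_pow (k + 1) t).const_mul (c k / (k + 1))
      refine this.congr_deriv ?_
      have : (k : ℝ) + 1 ≠ 0 := by positivity
      push_cast
      field_simp
    -- Integrate the polynomial found for the derivative, with the constant term chosen for
    -- agreement at `α`; the mean value inequality supplies one more factor `h`.
    refine ⟨fun k => k.casesOn (φ 0 α - P α) fun k => c k / (k + 1), fun t ht => ?_⟩
    have hα : α ∈ Set.Icc α (α + h) := ⟨le_rfl, by linarith⟩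
    have key := (convex_Icc α (α + h)).norm_image_sub_le_of_norm_hasDerivWithin_le
      (f := fun t => φ 0 t - P t)
      (fun s hs => ((hφ 0 (by omega) s (hsub hs)).mono hsub).sub (hP' s).hasDerivWithinAt)
      (C := B * h ^ a) (fun s hs => by simpa using hc s hs) hα ht
    rw [Finset.sum_range_succ']
    have hB0 : 0 ≤ B * h ^ a := (abs_nonneg _).trans (hc α hα)
    calc _ = ‖φ 0 t - P t - (φ 0 α - P α)‖ := by
          rw [Real.norm_eq_abs]; simp only [hP]; congr 1; simp; ring
      _ ≤ B * h ^ a * ‖t - α‖ := key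
      _ ≤ B * h ^ a * h := by
          refine mul_le_mul_of_nonneg_left ?_ hB0
          rw [Real.norm_eq_abs, abs_of_nonneg (by linarith [ht.1])]; linarith [ht.2]
      _ = _ := by ring

/-! ### Signed measures and coordinatewise integration -/

/-- The total variation of a finitely supported signed measure. -/
noncomputable def totalMass (w : ℝ →₀ ℝ) : ℝ := w.sum fun _ c => |c|

/-- All moments of order less than `a` vanish. -/
def KillsDegree (a : ℕ) (w : ℝ →₀ ℝ) : Prop := ∀ k < a, (w.sum fun t c => c * t ^ k) = 0

theorem abs_sum_le_totalMass {w : ℝ →₀ ℝ} {g : ℝ → ℝ} {B : ℝ}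
    (hg : ∀ t ∈ w.support, |g t| ≤ B) : |w.sum fun t c => c * g t| ≤ totalMass w * B := by
  rw [totalMass, Finsupp.sum, Finsupp.sum, Finset.sum_mul]
  refine (Finset.abs_sum_le_sum_abs _ _).trans (Finset.sum_le_sum fun t ht => ?_)
  rw [abs_mul]
  exact mul_le_mul_of_nonneg_left (hg t ht) (abs_nonneg _)

theorem abs_sum_le_of_killsDegree {w : ℝ →₀ ℝ} {g p : ℝ → ℝ} {a : ℕ} {B : ℝ} {c : ℕ → ℝ}
    (hw : KillsDegree a w) (hp : ∀ t, p t = ∑ k ∈ Finset.range a, c k * t ^ k)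
    (hg : ∀ t ∈ w.support, |g t - p t| ≤ B) : |w.sum fun t c => c * g t| ≤ totalMass w * B := by
  have h0 : (w.sum fun t b => b * p t) = 0 := by
    simp only [Finsupp.sum, hp, Finset.mul_sum]
    rw [Finset.sum_comm]
    refine Finset.sum_eq_zero fun k hk => ?_
    have := hw k (Finset.mem_range.1 hk)
    rw [Finsupp.sum] at this
    calc _ = c k * ∑ t ∈ w.support, w t * t ^ k := by
          rw [Finset.mul_sum]; exact Finset.sum_congr rfl fun _ _ => by ring
      _ = 0 := by rw [this, mul_zero]
  have : (w.sum fun t c => c * g t) = w.sum fun t c => c * (g t - p t) := by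
    simp only [mul_sub, Finsupp.sum_sub, h0, sub_zero]
  rw [this]
  exact abs_sum_le_totalMass hg

/-- Integration of `u` with respect to the listed measures in the listed coordinates. -/
noncomputable def coordIntegral {d : ℕ} :
    List (Fin d × (ℝ →₀ ℝ)) → ((Fin d → ℝ) → ℝ) → (Fin d → ℝ) → ℝ
  | [], u, y => u y
  | e :: l, u, y => e.2.sum fun t c => c * coordIntegral l u (Function.update y e.1 t)

section coordIntegral

variable {d : ℕ}

theorem coordIntegral_add (i : Fin d) (w w' : ℝ →₀ ℝ) (l : List (Fin d × (ℝ →₀ ℝ)))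
    (u : (Fin d → ℝ) → ℝ) (y : Fin d → ℝ) :
    coordIntegral ((i, w + w') :: l) u y =
      coordIntegral ((i, w) :: l) u y + coordIntegral ((i, w') :: l) u y := by
  simp only [coordIntegral]
  exact Finsupp.sum_add_index' (by simp) (by intros; ring)

theorem coordIntegral_single (i : Fin d) (l : List (Fin d × (ℝ →₀ ℝ)))
    (u : (Fin d → ℝ) → ℝ) (y : Fin d → ℝ) :
    coordIntegral ((i, Finsupp.single (y i) 1) :: l) u y = coordIntegral l u y := by
  simp [coordIntegral]

theorem hasDerivWithinAt_coordIntegral {l : List (Fin d × (ℝ →₀ ℝ))} {u v : (Fin d → ℝ) → ℝ}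
    {i : Fin d} (hi : ∀ e ∈ l, e.1 ≠ i) (hl : ∀ e ∈ l, ∀ t ∈ e.2.support, t ∈ Set.Icc (0 : ℝ) 1)
    (huv : ∀ x ∈ unitCube d,
      HasDerivWithinAt (fun t => u (Function.update x i t)) (v x) (Set.Icc 0 1) (x i))
    {x : Fin d → ℝ} (hx : x ∈ unitCube d) :
    HasDerivWithinAt (fun t => coordIntegral l u (Function.update x i t)) (coordIntegral l v x)
      (Set.Icc 0 1) (x i) := by
  induction l generalizing x with
  | nil => exact huv x hx
  | cons e l ih =>
    simp only [coordIntegral, Finsupp.sum]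
    refine HasDerivWithinAt.fun_sum fun s hs => HasDerivWithinAt.const_mul _ ?_
    have hei : e.1 ≠ i := hi e (by simp)
    have := ih (fun e he => hi e (by simp [he])) (fun e he => hl e (by simp [he]))
      (update_mem_unitCube hx (hl e (by simp) s hs) e.1)
    rw [Function.update_of_ne hei.symm] at this
    simpa only [Function.update_comm hei] using this

/-- Integration in the other coordinates commutes with differentiation in coordinate `i`. The inner
integral, as a function of that coordinate, is thus within `B * h ^ a` of a polynomial that `w`
kills. The gain `h ^ a` costs `a` derivatives of `u`; for `a = 0` only the total mass enters. -/
theorem abs_coordIntegral_cons_le {l : List (Fin d × (ℝ →₀ ℝ))} {u : (Fin d → ℝ) → ℝ}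
    {i : Fin d} {w : ℝ →₀ ℝ} {n a : ℕ} {M B α h : ℝ} (hh : 0 ≤ h)
    (hi : ∀ e ∈ l, e.1 ≠ i) (hl : ∀ e ∈ l, ∀ t ∈ e.2.support, t ∈ Set.Icc (0 : ℝ) 1)
    (hsub : Set.Icc α (α + h) ⊆ Set.Icc 0 1) (hw : ∀ t ∈ w.support, t ∈ Set.Icc α (α + h))
    (hkill : KillsDegree a w) (hu : PartialsBounded (n + a) M u)
    (hB : ∀ v, PartialsBounded n M v → ∀ y ∈ unitCube d, |coordIntegral l v y| ≤ B)
    {y : Fin d → ℝ} (hy : y ∈ unitCube d) :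
    |coordIntegral ((i, w) :: l) u y| ≤ totalMass w * (B * h ^ a) := by
  obtain ⟨v, rfl, hva, hv⟩ := hu.exists_iterated i
  obtain ⟨c, hc⟩ := exists_polynomial_approx
    (φ := fun k t => coordIntegral l (v k) (Function.update y i t)) (a := a) (B := B) hh hsub
    (fun k hk t ht => by
      have := hasDerivWithinAt_coordIntegral hi hl (hv k hk) (update_mem_unitCube hy ht i)
      simpa using this)
    (fun t ht => hB _ hva _ (update_mem_unitCube hy ht i))
  exact abs_sum_le_of_killsDegree hkill (fun t => rfl) fun t ht => hc t (hw t ht)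

/-- The nested sum evaluates `u` only at points all of whose coordinates lie in `G`. -/
theorem coordIntegral_eq_zero {G : Set ℝ} {l : List (Fin d × (ℝ →₀ ℝ))} {u : (Fin d → ℝ) → ℝ}
    (hl : ∀ e ∈ l, ∀ t ∈ e.2.support, t ∈ G) (hu : ∀ y, (∀ i, y i ∈ G) → u y = 0)
    {y : Fin d → ℝ} (hy : ∀ i, y i ∈ G ∨ ∃ e ∈ l, e.1 = i) : coordIntegral l u y = 0 := by
  induction l generalizing y with
  | nil => exact hu y fun i => by simpa using hy i
  | cons e l ih =>
    refine Finset.sum_eq_zero fun t ht => ?_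
    refine mul_eq_zero_of_right _ (ih (fun e he => hl e (by simp [he])) fun i => ?_)
    by_cases h : i = e.1
    · subst h; left; simpa using hl e (by simp) t ht
    · rw [Function.update_of_ne h]
      rcases hy i with h' | ⟨e', he', rfl⟩
      · exact Or.inl h'
      · rcases List.mem_cons.1 he' with rfl | h''
        · exact absurd rfl h
        · exact Or.inr ⟨e', h'', rfl⟩

end coordIntegral

theorem totalMass_add_le (v w : ℝ →₀ ℝ) : totalMass (v + w) ≤ totalMass v + totalMass w := by
  classical
  have h : ∀ u : ℝ →₀ ℝ, u.support ⊆ v.support ∪ w.support →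
      totalMass u = ∑ t ∈ v.support ∪ w.support, |u t| := fun u hu =>
    Finsupp.sum_of_support_subset _ hu _ (by simp)
  rw [h _ Finsupp.support_add, h v Finset.subset_union_left, h w Finset.subset_union_right,
    ← Finset.sum_add_distrib]
  exact Finset.sum_le_sum fun t _ => abs_add_le _ _

theorem totalMass_neg (w : ℝ →₀ ℝ) : totalMass (-w) = totalMass w := by
  rw [totalMass, Finsupp.sum_neg_index (by simp)]
  simp [totalMass]

theorem totalMass_sub_le (v w : ℝ →₀ ℝ) : totalMass (v - w) ≤ totalMass v + totalMass w := by
  rw [sub_eq_add_neg, ← totalMass_neg w]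
  exact totalMass_add_le _ _

theorem totalMass_single (t c : ℝ) : totalMass (Finsupp.single t c) = |c| := by
  simp [totalMass]

theorem totalMass_sum_le {ι : Type*} (s : Finset ι) (w : ι → ℝ →₀ ℝ) :
    totalMass (∑ i ∈ s, w i) ≤ ∑ i ∈ s, totalMass (w i) := by
  classical
  induction s using Finset.induction_on with
  | empty => simp [totalMass]
  | insert i s hi ih =>
    rw [Finset.sum_insert hi, Finset.sum_insert hi]
    exact (totalMass_add_le _ _).trans (by gcongr)

theorem killsDegree_iff {a : ℕ} {w : ℝ →₀ ℝ} :
    KillsDegree a w ↔ ∀ k < a, Finsupp.linearCombination ℝ (fun t : ℝ => t ^ k) w = 0 :=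
  Iff.rfl

/-! ### Splitting a point mass by interpolation -/

/-- The unit mass at `x` is split as `p + (q - p) + (δ_x - q)`, with all measures supported in
the interval `[α, α + h]`, and `p`, `q` supported in `G`. -/
structure IsSplitting (G : Set ℝ) (r : ℕ) (h Λ x α : ℝ) (p q : ℝ →₀ ℝ) : Prop where
  Icc_subset : Set.Icc α (α + h) ⊆ Set.Icc 0 1
  mem_Icc : x ∈ Set.Icc α (α + h)
  fst_mem : ∀ t ∈ p.support, t ∈ Set.Icc α (α + h) ∧ t ∈ G
  snd_mem : ∀ t ∈ q.support, t ∈ Set.Icc α (α + h) ∧ t ∈ G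
  totalMass_fst : totalMass p ≤ 1
  totalMass_snd_sub : totalMass (q - p) ≤ Λ
  totalMass_single_sub : totalMass (Finsupp.single x 1 - q) ≤ Λ
  killsDegree_snd_sub : KillsDegree 2 (q - p)
  killsDegree_single_sub : KillsDegree r (Finsupp.single x 1 - q)

namespace IsSplitting

variable {G : Set ℝ} {r : ℕ} {h Λ x α : ℝ} {p q : ℝ →₀ ℝ}

theorem snd_sub_mem (H : IsSplitting G r h Λ x α p q) :
    ∀ t ∈ (q - p).support, t ∈ Set.Icc α (α + h) ∧ t ∈ G := by
  classical
  intro t ht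
  rcases Finset.mem_union.1 (Finsupp.support_sub ht) with h | h
  · exact H.snd_mem t h
  · exact H.fst_mem t h

theorem single_sub_mem (H : IsSplitting G r h Λ x α p q) :
    ∀ t ∈ (Finsupp.single x 1 - q).support, t ∈ Set.Icc α (α + h) := by
  classical
  intro t ht
  rcases Finset.mem_union.1 (Finsupp.support_sub ht) with h | h
  · have := Finsupp.support_single_subset h
    rw [Finset.mem_singleton] at this
    exact this ▸ H.mem_Icc
  · exact (H.snd_mem t h).1

end IsSplitting

/-- The points `k / (N r)` of `[0, 1]`. -/
def gridSet (r N : ℕ) : Set ℝ := Set.range fun k : Fin (N * r + 1) => (k : ℝ) / (N * r)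

theorem exists_isSplitting {r N : ℕ} (hr : 2 ≤ r) (hN : 1 ≤ N) {x : ℝ}
    (hx : x ∈ Set.Icc (0 : ℝ) 1) :
    ∃ α p q, IsSplitting (gridSet r N) r (1 / N) ((r + 1) * r ^ r + 1) x α p q := by
  have hN0 : (0 : ℝ) < N := by exact_mod_cast hN
  have hr0 : (0 : ℝ) < r := by exact_mod_cast (by omega : 0 < r)
  obtain ⟨j, hjN, hj1, hj2⟩ : ∃ j : ℕ, j + 1 ≤ N ∧ (j : ℝ) ≤ N * x ∧ N * x ≤ j + 1 := by
    rcases lt_or_ge (N * x) N with h | h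
    · refine ⟨⌊N * x⌋₊, ?_, Nat.floor_le (mul_nonneg hN0.le hx.1), (Nat.lt_floor_add_one _).le⟩
      exact Nat.succ_le_of_lt ((Nat.floor_lt (mul_nonneg hN0.le hx.1)).2 h)
    -- The endpoint `x = 1` is assigned to the last cell.
    · refine ⟨N - 1, by omega, ?_, ?_⟩ <;> push_cast [Nat.cast_sub hN]
      · linarith
      · nlinarith [hx.2]
  have hjN' : (j : ℝ) + 1 ≤ N := by exact_mod_cast hjN
  set α : ℝ := j / N with hα
  have hx1 : α ≤ x := by rw [hα, div_le_iff₀ hN0]; linarith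
  have hx2 : x ≤ α + 1 / N := by
    rw [hα, ← add_div, le_div_iff₀ hN0]; linarith
  set node : ℕ → ℝ := fun l => α + l / (N * r) with hnode
  have hnode_mem : ∀ l ≤ r, node l ∈ Set.Icc α (α + 1 / N) ∧ node l ∈ gridSet r N := by
    intro l hl
    have hl' : (l : ℝ) ≤ r := by exact_mod_cast hl
    refine ⟨⟨by simp only [hnode]; linarith [(by positivity : 0 ≤ (l : ℝ) / (N * r))], ?_⟩, ?_⟩
    · have : (l : ℝ) / (N * r) ≤ 1 / N := by
        rw [div_le_div_iff₀ (by positivity) hN0]; nlinarith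
      simp only [hnode]
      linarith
    · refine ⟨⟨j * r + l, ?_⟩, ?_⟩
      · have : (j + 1) * r ≤ N * r := Nat.mul_le_mul_right r hjN
        rw [add_mul] at this; omega
      · simp only [hnode, hα]; push_cast; field_simp
  have hinj : Set.InjOn node (Finset.range (r + 1)) := by
    intro a _ b _ hab
    simp only [hnode, add_right_inj] at hab
    rw [div_left_inj' (by positivity)] at hab
    exact_mod_cast hab
  set s : ℝ := (x - α) * N with hs
  have hs0 : 0 ≤ s := mul_nonneg (by linarith) hN0.le
  have hs1 : s ≤ 1 := by
    have : (x - α) ≤ 1 / N := by linarith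
    rwa [le_div_iff₀ hN0] at this
  set p : ℝ →₀ ℝ := Finsupp.single (node 0) (1 - s) + Finsupp.single (node r) s with hp
  set b : ℕ → ℝ := fun l => (Lagrange.basis (Finset.range (r + 1)) node l).eval x with hb
  set q : ℝ →₀ ℝ := ∑ l ∈ Finset.range (r + 1), Finsupp.single (node l) (b l) with hq
  have hpm : totalMass p ≤ 1 := by
    refine (totalMass_add_le _ _).trans ?_
    rw [totalMass_single, totalMass_single, abs_of_nonneg hs0, abs_of_nonneg (by linarith)]
    linarith
  -- Each of the `r` factors of a Lagrange basis polynomial is at most the cell length `1 / N` over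
  -- the node spacing `1 / (N r)`, that is `r`.
  have hbl : ∀ l ∈ Finset.range (r + 1), |b l| ≤ (r : ℝ) ^ r := by
    intro l hl
    simp only [hb, Lagrange.basis, Polynomial.eval_prod, Finset.abs_prod]
    refine (Finset.prod_le_prod (g := fun _ => (r : ℝ)) (fun _ _ => abs_nonneg _)
      (fun l' hl' => ?_)).trans ?_
    · rw [Finset.mem_erase, Finset.mem_range] at hl'
      have hne : (l : ℝ) - l' ≠ 0 := by
        rw [sub_ne_zero]; exact_mod_cast hl'.1.symm
      have h1 : (1 : ℝ) ≤ |(l : ℝ) - l'| := by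
        have : (1 : ℤ) ≤ |(l : ℤ) - l'| := Int.one_le_abs (by omega)
        exact_mod_cast this
      have h2 : |x - node l'| ≤ 1 / N := by
        have := (hnode_mem l' (by omega)).1
        rw [abs_le]; constructor <;> linarith [this.1, this.2]
      have h3 : node l - node l' = (l - l') / (N * r) := by simp only [hnode]; ring
      rw [Lagrange.basisDivisor]
      simp only [Polynomial.eval_mul, Polynomial.eval_C, Polynomial.eval_sub, Polynomial.eval_X]
      rw [abs_mul, abs_inv, h3, abs_div, abs_of_pos (by positivity : (0 : ℝ) < N * r), inv_div]
      calc _ ≤ (N * r : ℝ) / 1 * (1 / N) := by gcongr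
        _ = r := by field_simp
    · rw [Finset.prod_const, Finset.card_erase_of_mem hl, Finset.card_range]; simp
  have hqm : totalMass q ≤ (r + 1) * (r : ℝ) ^ r := by
    refine (totalMass_sum_le _ _).trans ?_
    simp only [totalMass_single]
    refine (Finset.sum_le_sum hbl).trans ?_
    simp
  have hqk : ∀ k ≤ r, Finsupp.linearCombination ℝ (fun t : ℝ => t ^ k) q = x ^ k := by
    intro k hk
    have h := congrArg (Polynomial.eval x) (Lagrange.eq_interpolate (f := (Polynomial.X ^ k : Polynomial ℝ)) hinj
      (by rw [Polynomial.degree_X_pow, Finset.card_range]; exact_mod_cast (by omega : k < r + 1)))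
    rw [Lagrange.interpolate_apply, Polynomial.eval_finsetSum] at h
    simp only [Polynomial.eval_mul, Polynomial.eval_C, Polynomial.eval_pow, Polynomial.eval_X] at h
    rw [hq, map_sum, h]
    refine Finset.sum_congr rfl fun l _ => ?_
    rw [Finsupp.linearCombination_single, smul_eq_mul, mul_comm]
  have hpk : ∀ k < 2, Finsupp.linearCombination ℝ (fun t : ℝ => t ^ k) p = x ^ k := by
    intro k hk
    rw [hp, map_add, Finsupp.linearCombination_single, Finsupp.linearCombination_single]
    interval_cases k
    · simp
    · simp only [hnode, hs, smul_eq_mul]; field_simp; push_cast; ring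
  refine ⟨α, p, q, ⟨?_, ⟨hx1, hx2⟩, ?_, ?_, hpm, ?_, ?_, ?_, ?_⟩⟩
  · refine Set.Icc_subset_Icc (by positivity) ?_
    rw [hα, ← add_div, div_le_one hN0]; exact hjN'
  · intro t ht
    classical
    rcases Finset.mem_union.1 (Finsupp.support_add ht) with h | h
    · have := Finset.mem_singleton.1 (Finsupp.support_single_subset h)
      exact this ▸ hnode_mem 0 (by omega)
    · have := Finset.mem_singleton.1 (Finsupp.support_single_subset h)
      exact this ▸ hnode_mem r le_rfl
  · intro t ht
    classical
    obtain ⟨l, hl, h⟩ := Finset.mem_biUnion.1 (Finsupp.support_finsetSum ht)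
    have := Finset.mem_singleton.1 (Finsupp.support_single_subset h)
    exact this ▸ hnode_mem l (by rw [Finset.mem_range] at hl; omega)
  · exact (totalMass_sub_le _ _).trans (add_le_add hqm hpm)
  · refine (totalMass_sub_le _ _).trans ?_
    rw [totalMass_single, abs_one]; linarith
  · refine killsDegree_iff.2 fun k hk => ?_
    rw [map_sub, hqk k (by omega), hpk k hk, sub_self]
  · refine killsDegree_iff.2 fun k hk => ?_
    rw [map_sub, hqk k (by omega), Finsupp.linearCombination_single]; simp

/-! ### The stopped product expansion -/

section expansion

variable {d r : ℕ} {G : Set ℝ} {h Λ : ℝ} {x α : Fin d → ℝ} {p q : Fin d → ℝ →₀ ℝ}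

/-- The coordinate `e.1` together with the measure `q - p` or `p` there, as `e.2` tells. -/
noncomputable def labelledMeasure (p q : Fin d → ℝ →₀ ℝ) (e : Fin d × Bool) :
    Fin d × (ℝ →₀ ℝ) :=
  (e.1, if e.2 then q e.1 - p e.1 else p e.1)

theorem labelledMeasure_mem (H : ∀ i, IsSplitting G r h Λ (x i) (α i) (p i) (q i))
    (e : Fin d × Bool) {t : ℝ} (ht : t ∈ (labelledMeasure p q e).2.support) :
    t ∈ Set.Icc (α e.1) (α e.1 + h) ∧ t ∈ G := by
  rcases e with ⟨i, b⟩
  cases b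
  · exact (H i).fst_mem t (by simpa [labelledMeasure] using ht)
  · exact (H i).snd_sub_mem t (by simpa [labelledMeasure] using ht)

theorem labelledMeasure_map_ne {i : Fin d} {l : List (Fin d × Bool)} (hi : i ∉ l.map Prod.fst) :
    ∀ e ∈ l.map (labelledMeasure p q), e.1 ≠ i := by
  rintro _ he rfl
  obtain ⟨e', he', rfl⟩ := List.mem_map.1 he
  exact hi (List.mem_map.2 ⟨e', he', rfl⟩)

theorem labelledMeasure_map_mem (H : ∀ i, IsSplitting G r h Λ (x i) (α i) (p i) (q i))
    (l : List (Fin d × Bool)) : ∀ e ∈ l.map (labelledMeasure p q), ∀ t ∈ e.2.support,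
      t ∈ Set.Icc (0 : ℝ) 1 := by
  intro e he t ht
  obtain ⟨e', _, rfl⟩ := List.mem_map.1 he
  exact (H _).Icc_subset (labelledMeasure_mem H e' ht).1

/-- Factors `p` have mass at most 1 and are free. Each factor `q - p` costs `Λ` and gains `h ^ κ`:
`κ = 2` when derivatives are to spare, `κ = 0` when all are reserved for a factor `δ - q`. -/
theorem abs_coordIntegral_labelled_le (hh : 0 ≤ h)
    (H : ∀ i, IsSplitting G r h Λ (x i) (α i) (p i) (q i)) {κ : ℕ} (hκ : κ ≤ 2) {M : ℝ}
    (hM : 0 ≤ M) (hΛ : 1 ≤ Λ)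
    {l : List (Fin d × Bool)} (hl : (l.map Prod.fst).Nodup) {u : (Fin d → ℝ) → ℝ}
    (hu : PartialsBounded (κ * l.countP Prod.snd) M u) {y : Fin d → ℝ} (hy : y ∈ unitCube d) :
    |coordIntegral (l.map (labelledMeasure p q)) u y| ≤
      (Λ * h ^ κ) ^ l.countP Prod.snd * M := by
  induction l generalizing u y with
  | nil => simpa [coordIntegral] using hu.abs_le hy
  | cons e l ih =>
    rw [List.map_cons, List.nodup_cons] at hl
    obtain ⟨i, b⟩ := e
    cases b with
    | false =>
      simp only [List.countP_cons, Bool.false_eq_true, if_false, add_zero] at hu ⊢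
      have := abs_coordIntegral_cons_le (a := 0) hh (labelledMeasure_map_ne hl.1)
        (labelledMeasure_map_mem H l) (H i).Icc_subset (fun t ht => ((H i).fst_mem t ht).1)
        (by intro k hk; omega) hu (fun v hv z hz => ih hl.2 hv hz) hy
      refine this.trans ?_
      rw [pow_zero, mul_one]
      exact mul_le_of_le_one_left (by positivity) (H i).totalMass_fst
    | true =>
      simp only [List.countP_cons, if_true] at hu ⊢
      have := abs_coordIntegral_cons_le (a := κ) hh (labelledMeasure_map_ne hl.1)
        (labelledMeasure_map_mem H l) (H i).Icc_subset (fun t ht => ((H i).snd_sub_mem t ht).1)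
        (fun k hk => (H i).killsDegree_snd_sub k (by omega)) (by rwa [mul_add, mul_one] at hu)
        (fun v hv z hz => ih hl.2 hv hz) hy
      refine this.trans ((mul_le_mul_of_nonneg_right (H i).totalMass_snd_sub
        (by positivity)).trans_eq ?_)
      ring

/-- The recursion for the number of stopped branches: the next coordinate takes `p`, takes `q - p`,
or stops with `δ - q`. -/
theorem count_step (a k : ℕ) : (2 * a + 1) ^ (k + 1) + (2 * a + 1) ^ k + 1 ≤
    (2 * (a + 1) + 1) ^ (k + 1) := by
  have h1 : 1 ≤ (2 * a + 1) ^ k := Nat.one_le_pow _ _ (by omega)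
  have h2 : (2 * a + 1) ^ k ≤ (2 * (a + 1) + 1) ^ k := Nat.pow_le_pow_left (by omega) _
  rw [pow_succ, pow_succ]
  nlinarith

/-- Induction on the undecided coordinates `L`, which still carry the unit mass at `x i`; `l`
records the decided ones, and the `(k + 1)`-st further choice of `q - p` stops the branch. Each
stopped branch contributes at most `Λ ^ m * M * h ^ r`. -/
theorem abs_coordIntegral_le_of_eq_zero (hh : 0 ≤ h)
    (H : ∀ i, IsSplitting G r h Λ (x i) (α i) (p i) (q i)) {M : ℝ}
    (hM : 0 ≤ M) (hΛ : 1 ≤ Λ) (hx : x ∈ unitCube d) {u : (Fin d → ℝ) → ℝ}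
    (hu : PartialsBounded r M u) (hu0 : ∀ y, (∀ i, y i ∈ G) → u y = 0) {m : ℕ}
    (hm : r + 1 = 2 * m) (L : List (Fin d)) (l : List (Fin d × Bool)) (k : ℕ)
    (hk : l.countP Prod.snd + (k + 1) = m) (hnd : (L ++ l.map Prod.fst).Nodup)
    (hcov : ∀ i, i ∈ L ++ l.map Prod.fst) :
    |coordIntegral (l.map (labelledMeasure p q)) u x| ≤
      Λ ^ m * M * h ^ r * ((2 * L.length + 1) ^ (k + 1) : ℕ) := by
  have hK : 0 ≤ Λ ^ m * M * h ^ r := by positivity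
  induction L generalizing l k with
  | nil =>
    rw [coordIntegral_eq_zero (G := G) _ hu0 _, abs_zero]
    · positivity
    · intro e he t ht
      obtain ⟨e', _, rfl⟩ := List.mem_map.1 he
      exact (labelledMeasure_mem H e' ht).2
    · intro i
      obtain ⟨e, he, rfl⟩ := List.mem_map.1 (by simpa using hcov i : i ∈ l.map Prod.fst)
      exact Or.inr ⟨_, List.mem_map_of_mem he, rfl⟩
  | cons i L ih =>
    have hnd' : (i :: (L ++ l.map Prod.fst)).Nodup := hnd
    have hperm : ∀ b : Bool, (L ++ ((i, b) :: l).map Prod.fst).Perm (i :: (L ++ l.map Prod.fst)) :=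
      fun b => List.perm_middle
    have hnd2 : ∀ b : Bool, (L ++ ((i, b) :: l).map Prod.fst).Nodup :=
      fun b => (hperm b).nodup_iff.2 hnd'
    have hcov2 : ∀ (b : Bool) j, j ∈ L ++ ((i, b) :: l).map Prod.fst :=
      fun b j => (hperm b).mem_iff.2 (hcov j)
    rw [List.nodup_cons, List.mem_append, not_or] at hnd'
    have hnl := hnd'.1.2
    have hl : (l.map Prod.fst).Nodup := hnd'.2.of_append_right
    set E := fun w => coordIntegral ((i, w) :: l.map (labelledMeasure p q)) u x with hE
    have hsplit : coordIntegral (l.map (labelledMeasure p q)) u x =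
        E (p i) + E (q i - p i) + E (Finsupp.single (x i) 1 - q i) := by
      simp only [hE]
      rw [← coordIntegral_add, ← coordIntegral_add, ← coordIntegral_single i]
      congr 4
      abel
    have hΛpow : ∀ a ≤ m, Λ ^ a ≤ Λ ^ m := fun a ha => pow_le_pow_right₀ hΛ ha
    have h1 : |E (p i)| ≤ Λ ^ m * M * h ^ r * ((2 * L.length + 1) ^ (k + 1) : ℕ) := by
      have := ih ((i, false) :: l) k (by simpa using hk) (hnd2 _) (hcov2 _)
      simpa [labelledMeasure] using this
    -- All `r` derivatives go to coordinate `i`, so the decided coordinates contribute only their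
    -- masses.
    have h3 : |E (Finsupp.single (x i) 1 - q i)| ≤ Λ ^ m * M * h ^ r := by
      have := abs_coordIntegral_cons_le (a := r) (n := 0) (M := M) hh (labelledMeasure_map_ne hnl)
        (labelledMeasure_map_mem H l) (H i).Icc_subset (H i).single_sub_mem
        (H i).killsDegree_single_sub (by simpa using hu)
        (fun v hv z hz => abs_coordIntegral_labelled_le hh H (κ := 0) (by omega) hM hΛ hl
          (by simpa using hv) hz) hx
      refine this.trans ?_
      calc _ ≤ Λ * ((Λ * h ^ 0) ^ l.countP Prod.snd * M * h ^ r) := by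
            gcongr; exact (H i).totalMass_single_sub
        _ = Λ ^ (l.countP Prod.snd + 1) * (M * h ^ r) := by ring
        _ ≤ Λ ^ m * (M * h ^ r) := by gcongr; omega
        _ = _ := by ring
    have h2 : |E (q i - p i)| ≤ Λ ^ m * M * h ^ r * ((2 * L.length + 1) ^ k : ℕ) := by
      cases k with
      | succ k =>
        have := ih ((i, true) :: l) k (by simp; omega) (hnd2 _) (hcov2 _)
        simpa [labelledMeasure] using this
      | zero =>
        -- This is the `m`-th factor `q - p`. The earlier ones take two derivatives each and leave
        -- exactly one, so only its vanishing mass is used, for a gain of `h`.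
        have hr : r = 2 * l.countP Prod.snd + 1 := by omega
        have := abs_coordIntegral_cons_le (a := 1) (n := 2 * l.countP Prod.snd) (M := M) hh
          (labelledMeasure_map_ne hnl)
          (labelledMeasure_map_mem H l) (H i).Icc_subset (fun t ht => ((H i).snd_sub_mem t ht).1)
          (fun k hk => (H i).killsDegree_snd_sub k (by omega)) (by rwa [← hr])
          (fun v hv z hz => abs_coordIntegral_labelled_le hh H (κ := 2) le_rfl hM hΛ hl hv hz) hx
        refine this.trans ?_
        calc _ ≤ Λ * ((Λ * h ^ 2) ^ l.countP Prod.snd * M * h ^ 1) := by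
              gcongr; exact (H i).totalMass_snd_sub
          _ = Λ ^ (l.countP Prod.snd + 1) * M * h ^ (2 * l.countP Prod.snd + 1) := by ring
          _ = _ := by rw [← hr, hk]; simp
    rw [hsplit]
    have hstep : (((2 * L.length + 1) ^ (k + 1) : ℕ) : ℝ) + ((2 * L.length + 1) ^ k : ℕ) + 1 ≤
        ((2 * (L.length + 1) + 1) ^ (k + 1) : ℕ) := by exact_mod_cast count_step L.length k
    calc _ ≤ |E (p i)| + |E (q i - p i)| + |E (Finsupp.single (x i) 1 - q i)| := abs_add_three _ _ _
      _ ≤ Λ ^ m * M * h ^ r *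
          (((2 * L.length + 1) ^ (k + 1) : ℕ) + ((2 * L.length + 1) ^ k : ℕ) + 1) := by linarith
      _ ≤ _ := by rw [List.length_cons]; gcongr

end expansion

/-- A function with bounded partial derivatives that vanishes on the grid `{k / (N r)}^d` is
small on the whole cube. -/
theorem abs_le_of_eq_zero_on_grid {d r m N : ℕ} (hr : 2 ≤ r) (hm : r + 1 = 2 * m) (hN : 1 ≤ N)
    {M : ℝ} (hM : 0 ≤ M) {u : (Fin d → ℝ) → ℝ} (hu : PartialsBounded r M u)
    (hu0 : ∀ y, (∀ i, y i ∈ gridSet r N) → u y = 0) {x : Fin d → ℝ} (hx : x ∈ unitCube d) :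
    |u x| ≤ ((r + 1) * (r : ℝ) ^ r + 1) ^ m * M * (1 / N : ℝ) ^ r * (2 * d + 1) ^ m := by
  choose α p q H using fun i => exists_isSplitting hr hN (mem_unitCube_iff.1 hx i)
  have hΛ : (1 : ℝ) ≤ (r + 1) * (r : ℝ) ^ r + 1 := by
    have : (0 : ℝ) ≤ (r + 1) * (r : ℝ) ^ r := by positivity
    linarith
  obtain ⟨m, rfl⟩ : ∃ m', m = m' + 1 := ⟨m - 1, by omega⟩
  have := abs_coordIntegral_le_of_eq_zero (by positivity) H hM hΛ hx hu hu0 hm (List.finRange d) []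
    m (by simp) (by simpa using List.nodup_finRange d) (by simp)
  simpa [coordIntegral] using this

/-! ### Radial bump functions with dimension-free derivative bounds -/

section bump

variable {E : Type*} [NormedAddCommGroup E] [InnerProductSpace ℝ E]

theorem norm_iteratedFDeriv_smul_sub_le {R : ℝ} (hR : 0 < R) (y₀ y : E)
    (hy : ‖y - y₀‖ ≤ R) (i : ℕ) :
    ‖iteratedFDeriv ℝ i (fun z => R⁻¹ • (z - y₀)) y‖ ≤ R⁻¹ ^ i := by
  have hd : fderiv ℝ (fun z : E => R⁻¹ • (z - y₀)) = fun _ => R⁻¹ • ContinuousLinearMap.id ℝ E := by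
    ext1 z
    exact (((hasFDerivAt_id z).sub_const y₀).const_smul R⁻¹).fderiv
  rcases i with _ | i
  · rw [norm_iteratedFDeriv_zero, norm_smul, norm_inv, Real.norm_of_nonneg hR.le, pow_zero,
      inv_mul_le_iff₀ hR, mul_one]
    exact hy
  · rw [← norm_iteratedFDeriv_fderiv, hd]
    rcases i with _ | i
    · rw [norm_iteratedFDeriv_zero, norm_smul, norm_inv, Real.norm_of_nonneg hR.le, zero_add,
        pow_one]
      exact mul_le_of_le_one_right (by positivity) ContinuousLinearMap.norm_id_le
    · rw [iteratedFDeriv_succ_const]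
      simp only [Pi.zero_apply, norm_zero]
      positivity

theorem contDiff_smul_sub (R : ℝ) (y₀ : E) {n : WithTop ℕ∞} :
    ContDiff ℝ n (fun z => R⁻¹ • (z - y₀)) :=
  (contDiff_id.sub contDiff_const).const_smul R⁻¹

/-- Leibniz rule for the inner product of an affine map with itself; the binomial sum gives `2 ^ n`.
A bound of the form `D ^ n` is what the estimate for derivatives of compositions requires. -/
theorem norm_iteratedFDeriv_norm_sq_le {R : ℝ} (hR : 0 < R) (y₀ y : E)
    (hy : ‖y - y₀‖ ≤ R) (n : ℕ) :
    ‖iteratedFDeriv ℝ n (fun z => ‖R⁻¹ • (z - y₀)‖ ^ 2) y‖ ≤ (2 * R⁻¹) ^ n := by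
  have h := (innerSL ℝ (E := E)).norm_iteratedFDeriv_le_of_bilinear_of_le_one
    (contDiff_smul_sub R y₀ (n := n)) (contDiff_smul_sub R y₀ (n := n)) y le_rfl
    (norm_innerSL_le ℝ)
  have heq : (fun z : E => ‖R⁻¹ • (z - y₀)‖ ^ 2) =
      fun z => innerSL ℝ (R⁻¹ • (z - y₀)) (R⁻¹ • (z - y₀)) :=
    funext fun z => (real_inner_self_eq_norm_sq _).symm
  rw [heq]
  refine h.trans ?_
  calc _ ≤ ∑ i ∈ Finset.range (n + 1), (n.choose i : ℝ) * R⁻¹ ^ i * R⁻¹ ^ (n - i) := by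
        gcongr <;> exact norm_iteratedFDeriv_smul_sub_le hR _ _ hy _
    _ = ∑ i ∈ Finset.range (n + 1), (n.choose i : ℝ) * R⁻¹ ^ n := by
        refine Finset.sum_congr rfl fun i hi => ?_
        rw [mul_assoc, ← pow_add, Nat.add_sub_cancel' (by simpa [Nat.lt_succ_iff] using hi)]
    _ = _ := by
        rw [← Finset.sum_mul, mul_pow]
        congr 1
        exact_mod_cast Nat.sum_range_choose n

/-- The radial bump function of radius `R` around `y₀`. -/
noncomputable def radialBump (R : ℝ) (y₀ y : E) : ℝ :=
  Real.smoothTransition (1 - ‖R⁻¹ • (y - y₀)‖ ^ 2)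

theorem radialBump_self (R : ℝ) (y₀ : E) : radialBump R y₀ y₀ = 1 := by
  simp [radialBump]

theorem radialBump_eq_zero {R : ℝ} (hR : 0 < R) {y₀ y : E} (hy : R ≤ ‖y - y₀‖) :
    radialBump R y₀ y = 0 := by
  refine Real.smoothTransition.zero_of_nonpos ?_
  have : 1 ≤ ‖R⁻¹ • (y - y₀)‖ := by
    rw [norm_smul, norm_inv, Real.norm_of_nonneg hR.le, le_inv_mul_iff₀ hR, mul_one]
    exact hy
  nlinarith

theorem contDiff_radialBump (R : ℝ) (y₀ : E) {n : ℕ∞} : ContDiff ℝ n (radialBump R y₀) :=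
  Real.smoothTransition.contDiff.comp
    (contDiff_const.sub ((contDiff_norm_sq ℝ).comp (contDiff_smul_sub R y₀)))

theorem exists_norm_iteratedFDeriv_smoothTransition_le (r : ℕ) :
    ∃ C : ℝ, 0 < C ∧ ∀ i ≤ r, ∀ s ∈ Set.Icc (0 : ℝ) 1,
      ‖iteratedFDeriv ℝ i (fun s => Real.smoothTransition (1 - s)) s‖ ≤ C := by
  have hc : ∀ i : ℕ, ∃ C, ∀ s ∈ Set.Icc (0 : ℝ) 1,
      ‖iteratedFDeriv ℝ i (fun s => Real.smoothTransition (1 - s)) s‖ ≤ C := fun i => by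
    have : ContDiff ℝ ((i : ℕ∞) : WithTop ℕ∞) fun s => Real.smoothTransition (1 - s) :=
      Real.smoothTransition.contDiff.comp (contDiff_const.sub contDiff_id)
    exact isCompact_Icc.exists_bound_of_continuousOn
      (this.continuous_iteratedFDeriv (by simp)).continuousOn
  choose C hC using hc
  refine ⟨1 + ∑ i ∈ Finset.range (r + 1), |C i|, by positivity, fun i hi s hs => ?_⟩
  have : |C i| ≤ ∑ i ∈ Finset.range (r + 1), |C i| :=
    Finset.single_le_sum (f := fun i => |C i|) (fun _ _ => abs_nonneg _)
      (Finset.mem_range.2 (by omega))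
  linarith [hC i s hs, le_abs_self (C i)]

/-- The derivatives of radial bump functions are bounded independently of the dimension. -/
theorem norm_iteratedFDeriv_radialBump_le {r : ℕ} {C : ℝ} (hC0 : 0 < C)
    (hC : ∀ i ≤ r, ∀ s ∈ Set.Icc (0 : ℝ) 1,
      ‖iteratedFDeriv ℝ i (fun s => Real.smoothTransition (1 - s)) s‖ ≤ C)
    {R : ℝ} (hR : 0 < R) (y₀ y : E) {k : ℕ} (hk : k ≤ r) :
    ‖iteratedFDeriv ℝ k (radialBump R y₀) y‖ ≤ k.factorial * C * (2 * R⁻¹) ^ k := by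
  rcases le_or_gt ‖y - y₀‖ R with h | h
  · have h1 : ContDiff ℝ ((k : ℕ∞) : WithTop ℕ∞) fun s => Real.smoothTransition (1 - s) :=
      Real.smoothTransition.contDiff.comp (contDiff_const.sub contDiff_id)
    have h2 : ContDiff ℝ ((k : ℕ∞) : WithTop ℕ∞) fun z : E => ‖R⁻¹ • (z - y₀)‖ ^ 2 :=
      (contDiff_norm_sq ℝ).comp (contDiff_smul_sub R y₀)
    refine norm_iteratedFDeriv_comp_le h1 h2 le_rfl y (fun i hi => hC i (by omega) _ ?_)
      fun i _ _ => norm_iteratedFDeriv_norm_sq_le hR _ _ h i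
    refine ⟨by positivity, pow_le_one₀ (norm_nonneg _) ?_⟩
    rw [norm_smul, norm_inv, Real.norm_of_nonneg hR.le, inv_mul_le_iff₀ hR, mul_one]
    exact h
  · have : radialBump R y₀ =ᶠ[nhds y] fun _ => 0 := by
      have ho : IsOpen {z : E | R < ‖z - y₀‖} := isOpen_lt continuous_const (by fun_prop)
      filter_upwards [ho.mem_nhds h] with z hz
      exact radialBump_eq_zero hR (le_of_lt hz)
    rw [(this.iteratedFDeriv ℝ k).self_of_nhds, iteratedFDeriv_fun_zero]
    simp only [Pi.zero_apply, norm_zero]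
    positivity

end bump

/-- A scaled bump function in `𝒞^r_d`, whose height is of the order `R ^ r`. -/
theorem smul_radialBump_mem_smoothClass {r d : ℕ} {C : ℝ} (hC0 : 0 < C)
    (hC : ∀ i ≤ r, ∀ s ∈ Set.Icc (0 : ℝ) 1,
      ‖iteratedFDeriv ℝ i (fun s => Real.smoothTransition (1 - s)) s‖ ≤ C)
    {R : ℝ} (hR : 0 < R) (hR1 : R ≤ 1) (y₀ : EuclideanSpace ℝ (Fin d)) {κ : ℝ}
    (hκ : |κ| * (r.factorial * C * 2 ^ r) ≤ R ^ r) :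
    (fun x : Fin d → ℝ => κ * radialBump R y₀ (WithLp.toLp 2 x)) ∈ smoothClass r d := by
  set L : (Fin d → ℝ) →L[ℝ] EuclideanSpace ℝ (Fin d) :=
    (EuclideanSpace.equiv (Fin d) ℝ).symm.toContinuousLinearMap with hL
  set g : EuclideanSpace ℝ (Fin d) → ℝ := fun y => κ • radialBump R y₀ y with hg
  have hgc : ContDiff ℝ ((r : ℕ∞) : WithTop ℕ∞) g := (contDiff_radialBump R y₀).const_smul κ
  have hfun : (fun x : Fin d → ℝ => κ * radialBump R y₀ (WithLp.toLp 2 x)) = g ∘ L := rfl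
  rw [hfun]
  have hfc : ContDiff ℝ ((r : ℕ∞) : WithTop ℕ∞) (g ∘ L) := hgc.comp L.contDiff
  refine ⟨hfc.contDiffOn, fun k hk j x hx => ?_⟩
  have hk' : (k : WithTop ℕ∞) ≤ ((r : ℕ∞) : WithTop ℕ∞) := by exact_mod_cast hk
  rw [cubePartial, iteratedFDerivWithin_eq_iteratedFDeriv (uniqueDiffOn_unitCube d)
    (hfc.of_le hk').contDiffAt hx, L.iteratedFDeriv_comp_right hgc x hk',
    ContinuousMultilinearMap.compContinuousLinearMap_apply, ← Real.norm_eq_abs]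
  -- Coordinate directions are Euclidean unit vectors, so the operator norm bounds every partial
  -- derivative without loss in `d`.
  refine (ContinuousMultilinearMap.le_opNorm _ _).trans ?_
  have hLe : ∀ i : Fin d, L (Pi.single i 1) = EuclideanSpace.single i (1 : ℝ) := fun i => rfl
  simp only [hLe, PiLp.norm_single, norm_one, Finset.prod_const_one, mul_one]
  rw [hg, iteratedFDeriv_const_smul_apply'
    ((contDiff_radialBump R y₀ (n := (k : ℕ∞))).contDiffAt), norm_smul, Real.norm_eq_abs]
  have h1 : (k.factorial : ℝ) ≤ r.factorial := by exact_mod_cast Nat.factorial_le hk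
  have h2 : (2 * R⁻¹) ^ k ≤ (2 * R⁻¹) ^ r :=
    pow_le_pow_right₀ (by linarith [(one_le_inv₀ hR).2 hR1]) hk
  calc _ ≤ |κ| * (k.factorial * C * (2 * R⁻¹) ^ k) := by
        gcongr; exact norm_iteratedFDeriv_radialBump_le hC0 hC hR _ _ hk
    _ ≤ |κ| * (r.factorial * C * (2 * R⁻¹) ^ r) := by gcongr
    _ = |κ| * (r.factorial * C * 2 ^ r) * R⁻¹ ^ r := by rw [mul_pow]; ring
    _ ≤ R ^ r * R⁻¹ ^ r := by gcongr
    _ = 1 := by rw [← mul_pow, mul_inv_cancel₀ hR.ne', one_pow]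

/-! ### Volume of Euclidean balls and uncovered points -/

section volume

open Real

/-- Small Euclidean balls in high dimension have small volume. -/
theorem volume_ball_le {d : ℕ} (hd : 1 ≤ d) {R : ℝ} (hR : 0 < R)
    (y₀ : EuclideanSpace ℝ (Fin d)) :
    volume (Metric.ball y₀ R) ≤
      ENNReal.ofReal ((√(2 * π * Real.exp 1) * R / √d) ^ d) := by
  have hd0 : (0 : ℝ) < d := by exact_mod_cast hd
  -- The indicator of the ball is at most `exp (b * (R ^ 2 - ‖v‖ ^ 2))`; this `b` minimizes the
  -- integral of that Gaussian.
  set b : ℝ := d / (2 * R ^ 2) with hb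
  have hb0 : 0 < b := by positivity
  rw [Measure.addHaar_ball_center]
  have hI := GaussianFourier.integral_rexp_neg_mul_sq_norm (V := EuclideanSpace ℝ (Fin d)) hb0
  have hint : Integrable fun v : EuclideanSpace ℝ (Fin d) => Real.exp (-b * ‖v‖ ^ 2) := by
    by_contra h
    rw [integral_undef h] at hI
    exact (by positivity : (0 : ℝ) < (π / b) ^ (Module.finrank ℝ (EuclideanSpace ℝ (Fin d)) / 2 : ℝ)).ne hI
  have hle : volume (Metric.ball (0 : EuclideanSpace ℝ (Fin d)) R) ≤
      ∫⁻ v : EuclideanSpace ℝ (Fin d), ENNReal.ofReal (Real.exp (b * R ^ 2) * Real.exp (-b * ‖v‖ ^ 2)) := by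
    rw [← setLIntegral_one]
    refine (setLIntegral_mono' measurableSet_ball fun v hv => ?_).trans
      (setLIntegral_le_lintegral _ _)
    rw [← Real.exp_add, ENNReal.one_le_ofReal, Real.one_le_exp_iff]
    have : ‖v‖ < R := by simpa using hv
    have : ‖v‖ ^ 2 ≤ R ^ 2 := by gcongr
    nlinarith
  refine hle.trans ?_
  rw [← ofReal_integral_eq_lintegral_ofReal (hint.const_mul _)
    (Filter.Eventually.of_forall fun _ => by positivity), integral_const_mul, hI]
  refine ENNReal.ofReal_le_ofReal (le_of_eq ?_)
  have h1 : b * R ^ 2 = d / 2 := by rw [hb]; field_simp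
  have h2 : Real.exp (d / 2) = Real.exp 1 ^ ((d : ℝ) / 2) := by rw [← Real.exp_mul, one_mul]
  rw [h1, h2, finrank_euclideanSpace_fin, ← Real.mul_rpow (by positivity) (by positivity)]
  have h3 : Real.exp 1 * (π / b) = (√(2 * π * Real.exp 1) * R / √d) ^ 2 := by
    rw [div_pow, mul_pow, Real.sq_sqrt (by positivity), Real.sq_sqrt hd0.le, hb]
    field_simp
  rw [h3, ← Real.rpow_natCast _ 2, ← Real.rpow_mul (by positivity), ← Real.rpow_natCast]
  congr 1
  push_cast
  field_simp

/-- The balls around the points have total volume below 1, the volume of the open cube. An interior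
point is needed because the error is an essential supremum. -/
theorem exists_forall_le_dist {d n : ℕ} (hd : 1 ≤ d) {R : ℝ} (hR : 0 < R)
    (hn : n * (√(2 * π * Real.exp 1) * R / √d) ^ d < 1) (P : Fin n → Fin d → ℝ) :
    ∃ x₀ ∈ interior (unitCube d), ∀ i, R ≤ ‖WithLp.toLp 2 (P i) - WithLp.toLp 2 x₀‖ := by
  have hint : interior (unitCube d) = Set.univ.pi fun _ => Set.Ioo (0 : ℝ) 1 := by
    have : unitCube d = Set.univ.pi fun _ => Set.Icc (0 : ℝ) 1 := by
      ext x; simp only [mem_unitCube_iff, Set.mem_univ_pi]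
    rw [this, interior_pi_set Set.finite_univ]
    simp
  have hvol : volume (interior (unitCube d)) = 1 := by
    rw [hint, Real.volume_pi_Ioo]; simp
  set S : Set (Fin d → ℝ) := ⋃ i, WithLp.toLp 2 ⁻¹' Metric.ball (WithLp.toLp 2 (P i)) R with hS
  have hSv : volume S < 1 := by
    calc volume S ≤ ∑ i, volume (WithLp.toLp 2 ⁻¹' Metric.ball (WithLp.toLp 2 (P i)) R) :=
          measure_iUnion_fintype_le _ _
      _ = ∑ i, volume (Metric.ball (WithLp.toLp 2 (P i) : EuclideanSpace ℝ (Fin d)) R) := by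
          refine Finset.sum_congr rfl fun i _ => ?_
          exact (PiLp.volume_preserving_toLp (Fin d)).measure_preimage
            measurableSet_ball.nullMeasurableSet
      _ ≤ ∑ i : Fin n, ENNReal.ofReal ((√(2 * π * Real.exp 1) * R / √d) ^ d) :=
          Finset.sum_le_sum fun i _ => volume_ball_le hd hR _
      _ = ENNReal.ofReal (n * (√(2 * π * Real.exp 1) * R / √d) ^ d) := by
          rw [ENNReal.ofReal_mul (by positivity)]; simp
      _ < 1 := by rw [ENNReal.ofReal_lt_one]; exact hn
  by_contra! h
  have : interior (unitCube d) ⊆ S := fun x hx => by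
    obtain ⟨i, hi⟩ := h x hx
    exact Set.mem_iUnion.2 ⟨i, by
      rw [Set.mem_preimage, Metric.mem_ball, dist_comm, dist_eq_norm]; exact hi⟩
  exact absurd (measure_mono this) (by rw [hvol]; exact not_le.2 hSv)

end volume

/-! ### Information and worst case errors -/

namespace ApproxAlgorithm

variable {d : ℕ}

theorem info_apply (A : ApproxAlgorithm d) (f : (Fin d → ℝ) → ℝ) (n : ℕ) (i : Fin n) :
    A.info f n i = f (A.point i (A.info f i)) := by
  induction n with
  | zero => exact i.elim0
  | succ n ih =>
    induction i using Fin.lastCases with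
    | last => simp [info]
    | cast i => simpa [info] using ih i

/-- A function that vanishes at the points chosen for the zero function gives zero information. -/
theorem info_eq_zero (A : ApproxAlgorithm d) {f : (Fin d → ℝ) → ℝ} {n : ℕ}
    (hf : ∀ i : Fin n, f (A.point i 0) = 0) : A.info f n = 0 := by
  induction n with
  | zero => exact Subsingleton.elim _ _
  | succ n ih =>
    have h0 := ih fun i => hf i.castSucc
    have hlast := hf (Fin.last n)
    ext i
    induction i using Fin.lastCases with
    | last => simpa [info, h0] using hlast
    | cast i => simp [info, h0]

end ApproxAlgorithm

theorem ofReal_abs_le_eLpNorm_of_continuous {d : ℕ} {f : (Fin d → ℝ) → ℝ} (hf : Continuous f)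
    {x : Fin d → ℝ} (hx : x ∈ interior (unitCube d)) :
    ENNReal.ofReal |f x| ≤ eLpNorm f ∞ (volume.restrict (unitCube d)) := by
  by_contra! h
  set a := eLpNorm f ∞ (volume.restrict (unitCube d)) with ha
  have hU : IsOpen ({y | a < ‖f y‖ₑ} ∩ interior (unitCube d)) :=
    (isOpen_lt continuous_const hf.enorm).inter isOpen_interior
  have hpos := hU.measure_pos volume ⟨x, by
    simpa [← ofReal_norm] using h, hx⟩
  have hae : ∀ᵐ y ∂volume.restrict (unitCube d), ‖f y‖ₑ ≤ a := by
    rw [ha, eLpNorm_exponent_top]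
    exact ae_le_eLpNormEssSup
  have hmeas : MeasurableSet (unitCube d) := measurableSet_Icc
  rw [ae_restrict_iff' hmeas, ae_iff] at hae
  refine hpos.ne' (measure_mono_null (fun y hy => ?_) hae)
  simp only [Set.mem_ofPred_eq, not_forall, not_le]
  exact ⟨interior_subset hy.2, hy.1⟩

/-- Two functions `f`, `-f` of the class with vanishing information force an error of at
least the height of `f`. -/
theorem ofReal_abs_le_worstError {d : ℕ} (A : ApproxAlgorithm d) {F : Set ((Fin d → ℝ) → ℝ)}
    {f : (Fin d → ℝ) → ℝ} (hf : f ∈ F) (hf' : -f ∈ F) (hc : Continuous f)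
    (h0 : ∀ i : Fin A.cost, f (A.point i 0) = 0) {x : Fin d → ℝ}
    (hx : x ∈ interior (unitCube d)) : ENNReal.ofReal |f x| ≤ A.worstError F := by
  have h1 : A.apply (-f) = A.apply f := by
    rw [ApproxAlgorithm.apply, ApproxAlgorithm.apply, A.info_eq_zero h0,
      A.info_eq_zero (f := -f) fun i => by simp [h0 i]]
  set μ := volume.restrict (unitCube d) with hμ
  set g := A.apply f with hg
  have hle1 : eLpNorm (fun x => f x - g x) ∞ μ ≤ A.worstError F :=
    le_iSup₂_of_le f hf le_rfl
  have hle2 : eLpNorm (fun x => (-f) x - g x) ∞ μ ≤ A.worstError F :=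
    le_iSup₂_of_le (-f) hf' (by rw [h1])
  have hgm : AEStronglyMeasurable g μ := Lp.aestronglyMeasurable g
  have hfm : AEStronglyMeasurable f μ := hc.aestronglyMeasurable
  have hsub := eLpNorm_sub_le (p := ∞) (hfm.sub hgm) (hfm.neg.sub hgm) le_top
  have heq : (f - ⇑g) - (-f - ⇑g) = (2 : ℝ) • f := by
    ext y; simp; ring
  rw [heq] at hsub
  have h2 := ofReal_abs_le_eLpNorm_of_continuous (hc.const_smul (2 : ℝ)) hx
  have h3 : ENNReal.ofReal |((2 : ℝ) • f) x| = 2 * ENNReal.ofReal |f x| := by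
    rw [Pi.smul_apply, smul_eq_mul, abs_mul, ENNReal.ofReal_mul (by positivity)]
    simp
  have h4 : 2 * ENNReal.ofReal |f x| ≤ 2 * A.worstError F := by
    rw [← h3, two_mul (A.worstError F)]
    exact h2.trans (hsub.trans (add_le_add hle1 hle2))
  exact (ENNReal.mul_le_mul_iff_right (by simp) (by simp)).1 h4

/-- If functions of the class that agree at `n` given points are `ε`-close, then `n` function
values suffice for the error `ε`. -/
theorem minError_le_of_forall_abs_sub_le {d n : ℕ} {F : Set ((Fin d → ℝ) → ℝ)}
    (hF : ∀ f ∈ F, ContinuousOn f (unitCube d)) (P : Fin n → unitCube d) {ε : ℝ}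
    (h : ∀ f ∈ F, ∀ g ∈ F, (∀ i, f (P i) = g (P i)) → ∀ x ∈ unitCube d, |f x - g x| ≤ ε) :
    minError n F ≤ ENNReal.ofReal ε := by
  classical
  have hmeas : MeasurableSet (unitCube d) := measurableSet_Icc
  have hmem : ∀ f ∈ F, MemLp f ∞ (volume.restrict (unitCube d)) := fun f hf => by
    have hK : IsCompact (unitCube d) := isCompact_Icc
    obtain ⟨C, hC⟩ := hK.exists_bound_of_continuousOn (hF f hf)
    exact memLp_top_of_bound ((hF f hf).aestronglyMeasurable hmeas) C
      ((ae_restrict_iff' hmeas).2 (Filter.Eventually.of_forall hC))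
  -- The algorithm samples at `P` nonadaptively and returns any member of `F` that matches the data;
  -- the default values are never used for inputs in `F`.
  let A : ApproxAlgorithm d :=
    { cost := n
      point := fun i _ => if hi : i < n then P ⟨i, hi⟩ else ⟨0, by simp [mem_unitCube_iff]⟩
      output := fun y => if hy : ∃ f ∈ F, ∀ i, f (P i) = y i then
        (hmem hy.choose hy.choose_spec.1).toLp else 0 }
  refine iInf₂_le_of_le A le_rfl (iSup₂_le fun f hf => ?_)
  have hinfo : ∀ i : Fin n, A.info f n i = f (P i) := fun i => by
    rw [A.info_apply]; simp [A]
  have hy : ∃ g ∈ F, ∀ i, g (P i) = A.info f n i := ⟨f, hf, fun i => (hinfo i).symm⟩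
  have hout : A.apply f = (hmem hy.choose hy.choose_spec.1).toLp := dif_pos hy
  rw [hout, eLpNorm_exponent_top]
  refine eLpNormEssSup_le_of_ae_bound ?_
  filter_upwards [(hmem hy.choose hy.choose_spec.1).coeFn_toLp, ae_restrict_mem hmeas] with x hx hxc
  rw [hx, Real.norm_eq_abs]
  exact h f hf _ hy.choose_spec.1 (fun i => by rw [hy.choose_spec.2, hinfo]) x hxc

theorem nApp_le_of_minError_le {d n : ℕ} {F : Set ((Fin d → ℝ) → ℝ)} {ε : ℝ}
    (h : minError n F ≤ ENNReal.ofReal ε) : nApp ε F ≤ n :=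
  iInf₂_le n h

/-! ### The grid algorithm and the upper bound -/

theorem gridSet_subset (r N : ℕ) : gridSet r N ⊆ Set.Icc 0 1 := by
  rintro _ ⟨k, rfl⟩
  have : (k : ℝ) ≤ N * r := by exact_mod_cast Nat.lt_succ_iff.1 k.2
  exact ⟨by positivity, div_le_one_of_le₀ this (by positivity)⟩

theorem nApp_le_of_grid {d r m N : ℕ} (hr : 2 ≤ r) (hm : r + 1 = 2 * m) (hN : 1 ≤ N) {ε : ℝ}
    (hε : ((r + 1) * (r : ℝ) ^ r + 1) ^ m * 2 * (1 / N : ℝ) ^ r * (2 * d + 1) ^ m ≤ ε) :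
    nApp ε (smoothClass r d) ≤ ((N * r + 1) ^ d : ℕ) := by
  have hcard : Fintype.card (Fin d → Fin (N * r + 1)) = (N * r + 1) ^ d := by simp
  let e : Fin ((N * r + 1) ^ d) ≃ (Fin d → Fin (N * r + 1)) :=
    (Fintype.equivFinOfCardEq hcard).symm
  let P : Fin ((N * r + 1) ^ d) → unitCube d := fun i =>
    ⟨fun j => (e i j : ℝ) / (N * r), mem_unitCube_iff.2 fun j => gridSet_subset r N ⟨e i j, rfl⟩⟩
  refine nApp_le_of_minError_le (minError_le_of_forall_abs_sub_le
    (fun f hf => hf.1.continuousOn) P fun f hf g hg hfg x hx => ?_)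
  have hu := (partialsBounded_of_mem_smoothClass hf).sub (partialsBounded_of_mem_smoothClass hg)
  refine (abs_le_of_eq_zero_on_grid hr hm hN (by norm_num) hu (fun y hy => ?_) hx).trans ?_
  · choose k hk using hy
    have h1 : (P (e.symm k) : Fin d → ℝ) = y := by
      ext j; simpa [P] using hk j
    rw [← h1, hfg, sub_self]
  · norm_num at hε ⊢
    exact hε

/-- The zero output already has error at most 1. This covers large `ε`, where even the coarsest grid
would exceed the claimed bound. -/
theorem nApp_eq_zero_of_one_le {d r : ℕ} {ε : ℝ} (hε : 1 ≤ ε) :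
    nApp ε (smoothClass r d) = 0 := by
  have hbound : ∀ f ∈ smoothClass r d, ∀ x ∈ unitCube d, |f x| ≤ 1 := fun f hf x hx =>
    (partialsBounded_of_mem_smoothClass hf).abs_le hx
  refine le_antisymm (nApp_le_of_minError_le (n := 0) ?_) bot_le
  let A : ApproxAlgorithm d := ⟨0, fun _ _ => ⟨0, by simp [mem_unitCube_iff]⟩, fun _ => 0⟩
  refine iInf₂_le_of_le A le_rfl (iSup₂_le fun f hf => ?_)
  have hmeas : MeasurableSet (unitCube d) := measurableSet_Icc
  have hA : A.apply f = 0 := rfl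
  rw [hA, eLpNorm_exponent_top]
  refine eLpNormEssSup_le_of_ae_bound ?_
  filter_upwards [Lp.coeFn_zero ℝ ∞ (volume.restrict (unitCube d)), ae_restrict_mem hmeas]
    with x hx hxc
  rw [hx, Pi.zero_apply, sub_zero, Real.norm_eq_abs]
  exact (hbound f hf x hxc).trans hε

theorem smoothClass_upper_bound (r : ℕ) (hr : 3 ≤ r) (hodd : Odd r) :
    ∃ C : ℝ, 0 < C ∧ ∀ d : ℕ, 1 ≤ d → ∀ ε : ℝ, 0 < ε →
      (nApp ε (smoothClass r d) : ENNReal) ≤ ENNReal.ofReal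
        ((C * (d : ℝ) ^ (((r : ℝ) + 1) / (2 * (r : ℝ))) * ε ^ (-(1 / (r : ℝ)))) ^ d) := by
  obtain ⟨m, hm⟩ : ∃ m, r + 1 = 2 * m := by
    obtain ⟨k, rfl⟩ := hodd; exact ⟨k + 1, by ring⟩
  have hr0 : (0 : ℝ) < r := by exact_mod_cast (by omega : 0 < r)
  set Λ : ℝ := (r + 1) * (r : ℝ) ^ r + 1 with hΛ
  have hΛ1 : 1 ≤ Λ := by
    have : (0 : ℝ) ≤ (r + 1) * (r : ℝ) ^ r := by positivity
    linarith
  set K : ℝ := Λ ^ m * 2 * 3 ^ m with hK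
  have hK1 : 1 ≤ K := by
    have h1 : 1 ≤ Λ ^ m := one_le_pow₀ hΛ1
    have h2 : (1 : ℝ) ≤ 3 ^ m := one_le_pow₀ (by norm_num)
    nlinarith
  refine ⟨2 * (r + 1) * K ^ (1 / (r : ℝ)), by positivity, fun d hd ε hε => ?_⟩
  rcases le_or_gt 1 ε with h1 | h1
  · rw [nApp_eq_zero_of_one_le h1]; simp
  have hd1 : (1 : ℝ) ≤ d := by exact_mod_cast hd
  -- `T` is the real number of cells per axis at which the grid error bound, with `2 * d + 1 ≤ 3 *
  -- d` absorbed into `K`, equals `ε`. Since `T ≥ 1`, rounding up at most doubles it.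
  set T : ℝ := (K * d ^ m / ε) ^ (1 / (r : ℝ)) with hT
  have hbase : 1 ≤ K * d ^ m / ε := by
    rw [le_div_iff₀ hε]
    have : (1 : ℝ) ≤ d ^ m := one_le_pow₀ hd1
    nlinarith
  have hT1 : 1 ≤ T := Real.one_le_rpow hbase (by positivity)
  have hTr : T ^ r = K * d ^ m / ε := by
    rw [hT, ← Real.rpow_natCast, ← Real.rpow_mul (by positivity), one_div,
      inv_mul_cancel₀ hr0.ne', Real.rpow_one]
  have hTe : T = K ^ (1 / (r : ℝ)) * (d : ℝ) ^ (((r : ℝ) + 1) / (2 * (r : ℝ))) *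
      ε ^ (-(1 / (r : ℝ))) := by
    rw [hT, Real.div_rpow (by positivity) hε.le, Real.mul_rpow (by positivity) (by positivity),
      Real.rpow_neg hε.le, div_eq_mul_inv, ← Real.rpow_natCast, ← Real.rpow_mul (by positivity)]
    have : (m : ℝ) = ((r : ℝ) + 1) / 2 := by
      have : (r : ℝ) + 1 = 2 * m := by exact_mod_cast hm
      linarith
    rw [this]
    congr 3
    field_simp
  set N : ℕ := ⌈T⌉₊ with hN
  have hTN : T ≤ N := Nat.le_ceil T
  have hN1 : 1 ≤ N := by
    have : (1 : ℝ) ≤ N := hT1.trans hTN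
    exact_mod_cast this
  have hN2 : (N : ℝ) ≤ 2 * T := by
    have := Nat.ceil_lt_add_one (zero_le_one.trans hT1)
    linarith
  have hN0 : (0 : ℝ) < N := by exact_mod_cast hN1
  have hgrid := nApp_le_of_grid (d := d) (r := r) (m := m) (N := N) (ε := ε) (by omega) hm hN1 (by
    calc _ ≤ Λ ^ m * 2 * (1 / N : ℝ) ^ r * (3 * d) ^ m := by gcongr; linarith
      _ = K * d ^ m / N ^ r := by rw [mul_pow, hK, div_pow, one_pow]; ring
      _ ≤ K * d ^ m / T ^ r := by gcongr
      _ = ε := by rw [hTr]; field_simp)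
  have hgrid' : (nApp ε (smoothClass r d) : ENNReal) ≤ (((N * r + 1) ^ d : ℕ) : ℕ∞) := by
    exact_mod_cast hgrid
  refine hgrid'.trans ?_
  have hcast : ((((N * r + 1) ^ d : ℕ) : ℕ∞) : ENNReal) =
      ENNReal.ofReal (((N * r + 1) ^ d : ℕ) : ℝ) := by
    rw [ENNReal.ofReal_natCast]; rfl
  rw [hcast]
  refine ENNReal.ofReal_le_ofReal ?_
  push_cast
  refine pow_le_pow_left₀ (by positivity) ?_ d
  calc (N * r + 1 : ℝ) ≤ 2 * T * r + 1 := by gcongr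
    _ ≤ 2 * (r + 1) * T := by linarith
    _ = _ := by rw [hTe]; ring

/-! ### The lower bound -/

theorem smoothClass_lower_bound (r : ℕ) (hr : 1 ≤ r) :
    ∃ c ε₀ : ℝ, 0 < c ∧ 0 < ε₀ ∧ ∀ d : ℕ, 1 ≤ d → ∀ ε : ℝ, 0 < ε → ε < ε₀ →
      ENNReal.ofReal ((c * √(d : ℝ) * ε ^ (-(1 / (r : ℝ)))) ^ d)
        ≤ (nApp ε (smoothClass r d) : ENNReal) := by
  obtain ⟨C, hC0, hC⟩ := exists_norm_iteratedFDeriv_smoothTransition_le r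
  have hr0 : (0 : ℝ) < r := by exact_mod_cast hr
  set B : ℝ := 2 * (r.factorial * C * 2 ^ r) with hB
  have hB0 : 0 < B := by positivity
  set D : ℝ := √(2 * Real.pi * Real.exp 1) with hD
  have hD0 : 0 < D := Real.sqrt_pos.2 (by positivity)
  refine ⟨(D * B ^ (1 / (r : ℝ)))⁻¹, B⁻¹, by positivity, by positivity,
    fun d hd ε hε hε1 => ?_⟩
  have hd0 : (0 : ℝ) < d := by exact_mod_cast hd
  -- The radius at which a bump of height `2 * ε` just fits into the class; `ε < B⁻¹` ensures `R ≤
  -- 1`. Height `2 * ε` rather than `ε` makes the final contradiction strict.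
  set R : ℝ := (B * ε) ^ (1 / (r : ℝ)) with hR
  have hR0 : 0 < R := by positivity
  have hRr : R ^ r = B * ε := by
    rw [hR, ← Real.rpow_natCast, ← Real.rpow_mul (by positivity), one_div,
      inv_mul_cancel₀ hr0.ne', Real.rpow_one]
  have hR1 : R ≤ 1 := by
    refine Real.rpow_le_one (by positivity) ?_ (by positivity)
    have := mul_lt_mul_of_pos_left hε1 hB0
    rw [mul_inv_cancel₀ hB0.ne'] at this
    exact this.le
  have hbase : (D * B ^ (1 / (r : ℝ)))⁻¹ * √(d : ℝ) * ε ^ (-(1 / (r : ℝ))) =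
      (D * R / √d)⁻¹ := by
    rw [hR, Real.mul_rpow hB0.le hε.le, Real.rpow_neg hε.le]
    have : 0 < √(d : ℝ) := Real.sqrt_pos.2 hd0
    have : 0 < ε ^ (1 / (r : ℝ)) := by positivity
    have : 0 < B ^ (1 / (r : ℝ)) := by positivity
    field_simp
  rw [hbase]
  have hq : 0 < D * R / √d := by
    have : 0 < √(d : ℝ) := Real.sqrt_pos.2 hd0
    positivity
  have key : ∀ n : ℕ, minError n (smoothClass r d) ≤ ENNReal.ofReal ε →
      ((D * R / √d)⁻¹) ^ d ≤ n := by
    intro n hn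
    by_contra! hlt
    have hlt' : n * (D * R / √d) ^ d < 1 := by
      rw [inv_pow, ← one_div, lt_div_iff₀ (by positivity)] at hlt
      exact hlt
    have hge : ENNReal.ofReal (2 * ε) ≤ minError n (smoothClass r d) := by
      refine le_iInf₂ fun A hA => ?_
      have hA' : A.cost * (D * R / √d) ^ d < 1 := by
        refine lt_of_le_of_lt ?_ hlt'
        gcongr
      obtain ⟨x₀, hx₀, hx⟩ := exists_forall_le_dist hd hR0 hA'
        (fun i => (A.point i 0 : Fin d → ℝ))
      set y₀ : EuclideanSpace ℝ (Fin d) := WithLp.toLp 2 x₀ with hy₀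
      set f : (Fin d → ℝ) → ℝ := fun x => 2 * ε * radialBump R y₀ (WithLp.toLp 2 x) with hf
      have hf1 : f ∈ smoothClass r d :=
        smul_radialBump_mem_smoothClass hC0 hC hR0 hR1 y₀ (by
          rw [abs_of_pos (by positivity), hRr, hB]; exact le_of_eq (by ring))
      have hf2 : -f ∈ smoothClass r d := by
        have : -f = fun x => -(2 * ε) * radialBump R y₀ (WithLp.toLp 2 x) := by
          ext x; simp [hf]
        rw [this]
        exact smul_radialBump_mem_smoothClass hC0 hC hR0 hR1 y₀ (by
          rw [abs_neg, abs_of_pos (by positivity), hRr, hB]; exact le_of_eq (by ring))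
      have hfc : Continuous f := by
        have := (contDiff_radialBump R y₀ (n := 0)).continuous
        exact continuous_const.mul (this.comp (PiLp.continuous_toLp 2 _))
      have := ofReal_abs_le_worstError A hf1 hf2 hfc
        (fun i => by simp only [hf]; rw [radialBump_eq_zero hR0 (hx i), mul_zero]) hx₀
      have hval : |f x₀| = 2 * ε := by
        simp only [hf, ← hy₀, radialBump_self, mul_one]
        exact abs_of_pos (by positivity)
      rwa [hval] at this
    have := hge.trans hn
    rw [ENNReal.ofReal_le_ofReal_iff hε.le] at this
    linarith
  rcases eq_or_ne (nApp ε (smoothClass r d)) ⊤ with htop | htop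
  · rw [htop]; simp
  · have hle : (⌈((D * R / √d)⁻¹) ^ d⌉₊ : ℕ∞) ≤ nApp ε (smoothClass r d) :=
      le_iInf₂ fun n hn => by exact_mod_cast Nat.ceil_le.2 (key n hn)
    calc ENNReal.ofReal (((D * R / √d)⁻¹) ^ d)
        ≤ ENNReal.ofReal (⌈((D * R / √d)⁻¹) ^ d⌉₊ : ℝ) :=
          ENNReal.ofReal_le_ofReal (Nat.le_ceil _)
      _ = ((⌈((D * R / √d)⁻¹) ^ d⌉₊ : ℕ∞) : ENNReal) := by
          rw [ENNReal.ofReal_natCast]; rfl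
      _ ≤ _ := by exact_mod_cast hle

theorem theorem2 (r : ℕ) (hr : 3 ≤ r) (hodd : Odd r) :
    ∃ c C ε₀ : ℝ, 0 < c ∧ 0 < C ∧ 0 < ε₀ ∧
      ∀ d : ℕ, 1 ≤ d →
        (∀ ε : ℝ, 0 < ε → ε < ε₀ →
          ENNReal.ofReal ((c * √(d : ℝ) * ε ^ (-(1 / (r : ℝ)))) ^ d)
            ≤ (nApp ε (smoothClass r d) : ENNReal)) ∧
        (∀ ε : ℝ, 0 < ε →
          (nApp ε (smoothClass r d) : ENNReal) ≤
            ENNReal.ofReal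
              ((C * (d : ℝ) ^ (((r : ℝ) + 1) / (2 * (r : ℝ))) * ε ^ (-(1 / (r : ℝ)))) ^ d)) := by
  obtain ⟨c, ε₀, hc, hε₀, hlower⟩ := smoothClass_lower_bound r (by omega)
  obtain ⟨C, hC, hupper⟩ := smoothClass_upper_bound r hr hodd
  exact ⟨c, C, ε₀, hc, hC, hε₀, fun d hd => ⟨hlower d hd, hupper d hd⟩⟩
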